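/- Let $n,p\ge 1$ and let $f_1,\dots,f_n:\mathbb R^p\to\mathbb R$ be twice continuously differentiable, $f=\sum_{i=1}^n f_i$. Suppose there are $\mu,L>0$ and $M$ with $\mu I\preceq\nabla^2 f(x)\preceq MI$ and $\|\nabla^2 f(x)-\nabla^2 f(y)\|\le L\|x-y\|$ for all $x,y\in\mathbb R^p$ (spectral norm). Let $\mathcal G$ be a strongly connected directed network on the nodes $1,\dots,n$, whose nodes have distinct identifiers. **Flooding.** Each node $i$ starts with the set consisting of its own message, tagged with its identifier. In every round, simultaneously, each node sends to each of its (out-)neighbours $j$ one element of its current set, chosen arbitrarily, that it has not yet sent to $j$ (if there is one), and adds what it receives to its set. Two variants are allowed: (i) if $\mathcal G$ is undirected, the messages are sent along the edges of a fixed spanning tree of $\mathcal G$, a node moreover sends to $j$ only elements that it has not received from $j$, and there are $n-1$ rounds; (ii) the messages are sent along all edges of $\mathcal G$ and there are $n+d_{\mathcal G}-1$ rounds, where $d_{\mathcal G}$ is the diameter of $\mathcal G$. **DAN-LA.** Let $c>0$, $M_c=M+c$, $$\underline r=\tfrac13\sqrt{M_c^2+3\mu^2}-\tfrac{M_c}{3},\qquad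 \phi=\frac{2\mu(\mu-\underline r)^2}{L(M+\mu)}-\frac{2\underline r(\mu-\underline r)}{L}.$$ All nodes start at the same point $x_0^{(i)}=x_0\in\mathbb R^p$ with $H_{-1}^{(i)}=\hat H_{-1}^{(i)}=0$. At iteration $k=0,1,2,\dots$ every node $i$ does the following. 1. Let $\lambda_1,\lambda_2,\dots$ be the eigenvalues, with multiplicity, of $\nabla^2 f_i(x_k^{(i)})-H_{k-1}^{(i)}$ in order of decreasing magnitude ($\lambda_2:=0$ if $p=1$; ties are broken arbitrarily) and $w_1$ a unit eigenvector for $\lambda_1$. Set $h_k^{(i)}=\sqrt{|\lambda_1|}\,w_1$, $s_k^{(i)}=\operatorname{sign}(\lambda_1)$, $r_k^{(i)}=|\lambda_2|$. 2. Set $H_k^{(i)}=H_{k-1}^{(i)}+s_k^{(i)}h_k^{(i)}(h_k^{(i)})^{\mathsf T}$ and $g_k^{(i)}=\nabla f_i(x_k^{(i)})$. 3. Run the flooding, with the message $(r_k^{(i)},s_k^{(i)},g_k^{(i)},h_k^{(i)})$ at node $i$. Let $\mathcal S$ be the set of messages $(r,s,g,h)$, with their tags, that node $i$ has at the end, and set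 $\hat g_k^{(i)}=\sum_{\mathcal S}g$, $\hat H_k^{(i)}=\hat H_{k-1}^{(i)}+\sum_{\mathcal S}s\,hh^{\mathsf T}$, $\hat r_k^{(i)}=\sum_{\mathcal S}r$. 4. Set $\alpha_k^{(i)}=\min\{1,\phi/\|\hat g_k^{(i)}\|\}$ (that is $1$ if $\hat g_k^{(i)}=0$) if $\hat r_k^{(i)}\le\underline r$, and $\alpha_k^{(i)}=0$ otherwise. 5. Set $x_{k+1}^{(i)}=x_k^{(i)}$ if $\alpha_k^{(i)}=0$, and $x_{k+1}^{(i)}=x_k^{(i)}-\alpha_k^{(i)}(\hat H_k^{(i)})^{-1}\hat g_k^{(i)}$ otherwise. **Claim.** $f$ has a unique minimizer $x^\star$, and for every $c>0$, every starting point $x_0$, every execution of DAN-LA and every node $i$, the sequence $\|x_k^{(i)}-x^\star\|$ converges to $0$ R-superlinearly: there is a sequence of nonzero reals $e_k\to0$ with $|e_{k+1}|/|e_k|\to0$ and $\|x_k^{(i)}-x^\star\|\le|e_k|$ for all $k$. -/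

import Mathlib

namespace DistributedNewton

/-! ### Convergence rates -/

/-- `e` converges to `0` with a Q-superlinear rate: `e k → 0` and `|e (k+1)| / |e k| → 0`
(all terms nonzero, so that the quotients make sense). -/
def QSuperlinear (e : ℕ → ℝ) : Prop :=
  (∀ k, e k ≠ 0) ∧ Filter.Tendsto e Filter.atTop (nhds 0) ∧
    Filter.Tendsto (fun k => |e (k + 1)| / |e k|) Filter.atTop (nhds 0)

/-- `ε` converges to `0` with an R-superlinear rate: it is dominated, for every index, by a
Q-superlinearly convergent sequence. -/
def RSuperlinear (ε : ℕ → ℝ) : Prop :=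
  ∃ e : ℕ → ℝ, QSuperlinear e ∧ ∀ k, |ε k| ≤ |e k|

/-! ### Networks -/

/-- There is a directed path with exactly `t` edges from `i` to `j`. -/
def HasPath {n : ℕ} (G : Digraph (Fin n)) : ℕ → Fin n → Fin n → Prop
  | 0, i, j => i = j
  | t + 1, i, j => ∃ l, HasPath G t i l ∧ G.Adj l j

/-- Every node is joined to every node by a directed path. -/
def StronglyConnected {n : ℕ} (G : Digraph (Fin n)) : Prop :=
  ∀ i j, ∃ t, HasPath G t i j

/-- The number of edges in a shortest directed path from `i` to `j`. -/
noncomputable def distance {n : ℕ} (G : Digraph (Fin n)) (i j : Fin n) : ℕ :=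
  sInf {t | HasPath G t i j}

/-- The largest distance between any pair of nodes. -/
noncomputable def diameter {n : ℕ} (G : Digraph (Fin n)) : ℕ :=
  Finset.univ.sup fun ij : Fin n × Fin n => distance G ij.1 ij.2

/-- The two variants of distributed selective flooding on the network `G`
(`G.Adj i j` means that node `i` can directly send messages to node `j`).
* `undirected`: `G` is undirected, and the flooding is run along a spanning tree `T` of `G`.
* `directed`: the flooding is run along all edges of `G`. -/
inductive Protocol {n : ℕ} (G : Digraph (Fin n)) : Type
  | undirected (T : SimpleGraph (Fin n)) (symm : ∀ i j, G.Adj i j → G.Adj j i)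
      (spanning : ∀ i j, T.Adj i j → G.Adj i j) (tree : T.IsTree) : Protocol G
  | directed : Protocol G

/-- The links used by the protocol. -/
def Protocol.Link {n : ℕ} {G : Digraph (Fin n)} : Protocol G → Fin n → Fin n → Prop
  | .undirected T _ _ _, i, j => T.Adj i j
  | .directed, i, j => G.Adj i j

/-- The number of communication rounds in one execution of the flooding. -/
noncomputable def Protocol.rounds {n : ℕ} {G : Digraph (Fin n)} : Protocol G → ℕ
  | .undirected _ _ _ _ => n - 1
  | .directed => n + diameter G - 1

/-- `P.Eligible known sent t i j e`: after `t` rounds, node `i` may select the element `e` for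
sending it to node `j`, i.e. node `i` has `e`, has not sent it to `j` before and, in the
undirected variant, has not received it from `j` before. Here `known t i` is the information of
node `i` after `t` rounds and `sent t i j` is what `i` sends to `j` in the following round. -/
def Protocol.Eligible {n : ℕ} {G : Digraph (Fin n)} {α : Type*} (P : Protocol G)
    (known : ℕ → Fin n → Finset α) (sent : ℕ → Fin n → Fin n → Option α)
    (t : ℕ) (i j : Fin n) (e : α) : Prop :=
  e ∈ known t i ∧ (∀ l < t, sent l i j ≠ some e) ∧
    match P with
    | .undirected _ _ _ _ => ∀ l < t, sent l j i ≠ some e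
    | .directed => True

/-- An execution of the flooding in which node `i` starts with the message `S i`. In every round,
over every link, a node sends an arbitrary eligible element if there is one, and nothing else. -/
structure Protocol.IsRun {n : ℕ} {G : Digraph (Fin n)} {α : Type*} (P : Protocol G)
    (S : Fin n → α) (known : ℕ → Fin n → Finset α) (sent : ℕ → Fin n → Fin n → Option α) :
    Prop where
  init : ∀ i, known 0 i = {S i}
  sends_eligible : ∀ t i j e, sent t i j = some e → P.Link i j ∧ P.Eligible known sent t i j e
  sends_if_possible : ∀ t i j, P.Link i j → sent t i j = none →
    ∀ e, ¬ P.Eligible known sent t i j e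
  receives : ∀ t i e, e ∈ known (t + 1) i ↔ e ∈ known t i ∨ ∃ j, sent t j i = some e

/-! ### The algorithm -/

/-- The Hessian of `f` at `x`, as a linear operator; its operator norm is the spectral norm. -/
noncomputable def hessian {p : ℕ} (f : EuclideanSpace ℝ (Fin p) → ℝ)
    (x : EuclideanSpace ℝ (Fin p)) :
    EuclideanSpace ℝ (Fin p) →L[ℝ] EuclideanSpace ℝ (Fin p) :=
  fderiv ℝ (gradient f) x

/-- The rank-one operator `s • h hᵀ`. -/
noncomputable def signedOuter {p : ℕ} (s : ℝ) (h : EuclideanSpace ℝ (Fin p)) :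
    EuclideanSpace ℝ (Fin p) →L[ℝ] EuclideanSpace ℝ (Fin p) :=
  s • InnerProductSpace.rankOne ℝ h h

/-- `(s, h, r)` is a result of the rank-one eigen-approximation of the symmetric operator `A`:
for eigenvalues `lam 0, lam 1, …` of `A` (with multiplicity, in order of decreasing magnitude) and
orthonormal eigenvectors `w 0, w 1, …`, one has `h = √|lam 0| w 0`, `s = sign (lam 0)` and
`r = |lam 1|` (which is read as `0` in dimension one). Ties are broken arbitrarily. -/
def IsRankOneApprox {p : ℕ} [NeZero p]
    (A : EuclideanSpace ℝ (Fin p) →L[ℝ] EuclideanSpace ℝ (Fin p))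
    (s : ℝ) (h : EuclideanSpace ℝ (Fin p)) (r : ℝ) : Prop :=
  ∃ (lam : Fin p → ℝ) (w : OrthonormalBasis (Fin p) ℝ (EuclideanSpace ℝ (Fin p))),
    (∀ j, A (w j) = lam j • w j) ∧ Antitone (fun j => |lam j|) ∧
    h = √|lam 0| • w 0 ∧ s = Real.sign (lam 0) ∧
    r = if hp : 1 < p then |lam ⟨1, hp⟩| else 0

/-- The threshold `r̲ = (√(M_c² + 3μ²) - M_c) / 3` with `M_c = M + c`. -/
noncomputable def threshold (μ M c : ℝ) : ℝ :=
  1 / 3 * √((M + c) ^ 2 + 3 * μ ^ 2) - (M + c) / 3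

/-- The constant `φ = 2μ(μ - r̲)² / (L(M + μ)) - 2r̲(μ - r̲) / L`. -/
noncomputable def phi (μ L M c : ℝ) : ℝ :=
  2 * μ * (μ - threshold μ M c) ^ 2 / (L * (M + μ)) -
    2 * threshold μ M c * (μ - threshold μ M c) / L

open Classical in
/-- The stepsize: `min {1, φ / ‖g‖}` (that is `1` if `g = 0`) if the error bound `r` is at most
the threshold, and `0` otherwise. -/
noncomputable def stepsize {p : ℕ} (μ L M c r : ℝ) (g : EuclideanSpace ℝ (Fin p)) : ℝ :=
  if r ≤ threshold μ M c then (if g = 0 then 1 else min 1 (phi μ L M c / ‖g‖)) else 0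

/-- The message `(r, s, g, h)` that a node shares. -/
structure Message (p : ℕ) where
  r : ℝ
  s : ℝ
  g : EuclideanSpace ℝ (Fin p)
  h : EuclideanSpace ℝ (Fin p)

open Classical in
/-- An execution of DAN-LA from the common starting point `x₀`. Node `i` has the local objective
`f i` and the identifier `ident i`, which is attached to its messages. The sequences `H` and
`Hhat` of local and global Hessian estimates are shifted by one: `H k i` and `Hhat k i` are the
estimates available before iteration `k`, and `H (k + 1) i`, `Hhat (k + 1) i` those computed in
iteration `k`. -/
structure DANLA {n p : ℕ} [NeZero p] {ι : Type*} {G : Digraph (Fin n)} (P : Protocol G)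
    (ident : Fin n → ι) (f : Fin n → EuclideanSpace ℝ (Fin p) → ℝ) (μ L M c : ℝ)
    (x₀ : EuclideanSpace ℝ (Fin p)) where
  /-- decision vectors -/
  x : ℕ → Fin n → EuclideanSpace ℝ (Fin p)
  /-- local gradients -/
  g : ℕ → Fin n → EuclideanSpace ℝ (Fin p)
  /-- vectors of the rank-one approximations -/
  h : ℕ → Fin n → EuclideanSpace ℝ (Fin p)
  /-- signs of the rank-one approximations -/
  s : ℕ → Fin n → ℝ
  /-- local approximation errors -/
  r : ℕ → Fin n → ℝ
  /-- local Hessian estimates -/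
  H : ℕ → Fin n → EuclideanSpace ℝ (Fin p) →L[ℝ] EuclideanSpace ℝ (Fin p)
  /-- `known k t i`: the tagged messages at node `i` after `t` rounds in iteration `k` -/
  known : ℕ → ℕ → Fin n → Finset (ι × Message p)
  /-- `sent k t i j`: what node `i` sends to node `j` after `t` rounds in iteration `k` -/
  sent : ℕ → ℕ → Fin n → Fin n → Option (ι × Message p)
  /-- gradients assembled by the nodes -/
  ghat : ℕ → Fin n → EuclideanSpace ℝ (Fin p)
  /-- global Hessian estimates of the nodes -/
  Hhat : ℕ → Fin n → EuclideanSpace ℝ (Fin p) →L[ℝ] EuclideanSpace ℝ (Fin p)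
  /-- accumulated approximation errors -/
  rhat : ℕ → Fin n → ℝ
  /-- stepsizes -/
  α : ℕ → Fin n → ℝ
  x_zero : ∀ i, x 0 i = x₀
  H_zero : ∀ i, H 0 i = 0
  Hhat_zero : ∀ i, Hhat 0 i = 0
  rankOne : ∀ k i, IsRankOneApprox (hessian (f i) (x k i) - H k i) (s k i) (h k i) (r k i)
  H_succ : ∀ k i, H (k + 1) i = H k i + signedOuter (s k i) (h k i)
  g_eq : ∀ k i, g k i = gradient (f i) (x k i)
  flooding : ∀ k, P.IsRun (fun u => (ident u, ⟨r k u, s k u, g k u, h k u⟩)) (known k) (sent k)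
  ghat_eq : ∀ k i, ghat k i = ∑ m ∈ known k P.rounds i, m.2.g
  Hhat_succ : ∀ k i,
    Hhat (k + 1) i = Hhat k i + ∑ m ∈ known k P.rounds i, signedOuter m.2.s m.2.h
  rhat_eq : ∀ k i, rhat k i = ∑ m ∈ known k P.rounds i, m.2.r
  α_eq : ∀ k i, α k i = stepsize μ L M c (rhat k i) (ghat k i)
  x_succ : ∀ k i, x (k + 1) i =
    if α k i = 0 then x k i else x k i - α k i • (Hhat (k + 1) i).inverse (ghat k i)

end DistributedNewton

/-!
After each flooding every node holds every message. Indeed, a link that has carried fewer than `t`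
elements in `t` rounds was idle in one of them, and at that time everything its tail knew had
already passed through it. By induction on `s`, a node holds after `t` rounds at least `t + 1 - s`
elements or all messages from distance at most `s`; for `s` the diameter and `t = n + s - 1` both
mean all messages. A similar count works along a tree. Hence all nodes carry out the same inexact
Newton iteration for `∇f`, where `f = ∑ i, f i`, and `rhat` bounds the distance of the Hessian
estimate to the true Hessian.

A rank-one correction lowers by one the codimension of a subspace on which the error of a local
estimate is small, while the drift of the Hessian only adds to its size. So `p` iterations later the
error is at most the drift over these iterations, and it tends to zero along convergent iterates.
In particular the method cannot idle forever. With `T = threshold` and `θ = μ / (M + μ)`, the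
residual `u = ‖∇f‖` satisfies `u₊ ≤ u - (1 - θ) min(u, φ)` in every iteration whose error is at
most `T` and is constant in the others, so it tends to zero. Then the errors tend to zero, the steps
become full Newton steps, and the contraction factor of the residual tends to zero.
-/

namespace DistributedNewton

/-! ### Flooding -/

section Flooding

open scoped Finset

variable {n : ℕ} {G : Digraph (Fin n)} {α : Type*} {sent : ℕ → Fin n → Fin n → Option α}
  {t u : ℕ} {i j k l : Fin n} {e : α}

open Classical in
/-- The set of elements that node `i` sends to node `j` in the first `t` rounds of a flooding. -/
noncomputable def sentSet (sent : ℕ → Fin n → Fin n → Option α) (t : ℕ) (i j : Fin n) :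
    Finset α :=
  (Finset.range t).biUnion fun l => (sent l i j).toFinset

theorem mem_sentSet : e ∈ sentSet sent t i j ↔ ∃ l < t, sent l i j = some e := by
  simp [sentSet]

theorem sentSet_mono (sent : ℕ → Fin n → Fin n → Option α) (i j : Fin n) :
    Monotone fun t => sentSet sent t i j := fun _ _ htu _ he =>
  let ⟨l, hl, hs⟩ := mem_sentSet.1 he
  mem_sentSet.2 ⟨l, hl.trans_le htu, hs⟩

namespace Protocol.IsRun

variable {P : Protocol G} {S : Fin n → α} {known : ℕ → Fin n → Finset α}

theorem known_mono (h : P.IsRun S known sent) (i : Fin n) : Monotone fun t => known t i :=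
  monotone_nat_of_le_succ fun t _ he => (h.receives t i _).2 (.inl he)

theorem own_mem_known (h : P.IsRun S known sent) (t : ℕ) (i : Fin n) : S i ∈ known t i :=
  h.known_mono i (Nat.zero_le t) (by simp [h.init])

theorem sentSet_subset_known (h : P.IsRun S known sent) (t : ℕ) (i j : Fin n) :
    sentSet sent t i j ⊆ known t j := by
  intro e he
  obtain ⟨l, hl, hs⟩ := mem_sentSet.1 he
  exact h.known_mono j (Nat.succ_le_of_lt hl) ((h.receives l j e).2 (.inr ⟨i, hs⟩))

theorem mem_known_iff (h : P.IsRun S known sent) :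
    e ∈ known t i ↔ e = S i ∨ ∃ j, e ∈ sentSet sent t j i := by
  induction t with
  | zero => simp [h.init, mem_sentSet]
  | succ t ih =>
    rw [h.receives, ih, or_assoc, ← exists_or]
    refine or_congr_right (exists_congr fun j => ?_)
    simp only [mem_sentSet, Nat.lt_succ_iff_lt_or_eq, or_and_right, exists_or, exists_eq_left]

theorem exists_eq_of_mem_known (h : P.IsRun S known sent) (he : e ∈ known t i) :
    ∃ l, S l = e := by
  induction t generalizing i with
  | zero => exact ⟨i, by simpa [h.init, eq_comm] using he⟩
  | succ t ih =>
    rcases (h.receives t i e).1 he with he | ⟨j, hj⟩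
    · exact ih he
    · exact ih (h.sends_eligible t j i e hj).2.1

theorem mem_known_of_le_card (h : P.IsRun S known sent) (hn : n ≤ #(known t i)) (l : Fin n) :
    S l ∈ known t i := by
  classical
  have hsub : known t i ⊆ Finset.univ.image S := fun e he => by
    simpa using h.exists_eq_of_mem_known he
  rw [Finset.eq_of_subset_of_card_le hsub (Finset.card_image_le.trans (by simpa using hn))]
  exact Finset.mem_image_of_mem S (Finset.mem_univ l)

theorem card_sentSet_succ_or (h : P.IsRun S known sent) (hij : P.Link i j) (t : ℕ) :
    #(sentSet sent t i j) + 1 ≤ #(sentSet sent (t + 1) i j) ∨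
      ∀ e, ¬ P.Eligible known sent t i j e := by
  cases hs : sent t i j with
  | none => exact .inr (h.sends_if_possible t i j hij hs)
  | some e =>
    have hsub : sentSet sent t i j ⊆ sentSet sent (t + 1) i j := sentSet_mono sent i j t.le_succ
    have hmem : e ∈ sentSet sent (t + 1) i j := mem_sentSet.2 ⟨t, t.lt_succ_self, hs⟩
    have hnew : e ∉ sentSet sent t i j := fun he =>
      let ⟨l, hl, hsl⟩ := mem_sentSet.1 he
      (h.sends_eligible t i j e hs).2.2.1 l hl hsl
    exact .inl (Finset.card_lt_card ((Finset.ssubset_iff_of_subset hsub).2 ⟨e, hmem, hnew⟩))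

/-- If `i` did not send in all of the first `t` rounds, take for `u` the last round in which it was
idle: in each of the `t - u - 1` rounds after it, `i` sent a new element. -/
theorem le_card_sentSet_or_exists_idle (h : P.IsRun S known sent) (hij : P.Link i j) (t : ℕ) :
    t ≤ #(sentSet sent t i j) ∨
      ∃ u < t, t + #(sentSet sent u i j) ≤ #(sentSet sent t i j) + u + 1 ∧
        ∀ e, ¬ P.Eligible known sent u i j e := by
  induction t with
  | zero => exact .inl (Nat.zero_le _)
  | succ t ih =>
    rcases h.card_sentSet_succ_or hij t with hsend | hidle
    · rcases ih with ih | ⟨u, hu, hcard, hidle⟩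
      · exact .inl (by omega)
      · exact .inr ⟨u, by omega, by omega, hidle⟩
    · have : #(sentSet sent t i j) ≤ #(sentSet sent (t + 1) i j) :=
        Finset.card_le_card (sentSet_mono sent i j t.le_succ)
      exact .inr ⟨t, by omega, by omega, hidle⟩

/-! #### Flooding over all links -/

section Directed

theorem known_subset_sentSet_of_idle
    (hidle : ∀ e, ¬ (Protocol.directed : Protocol G).Eligible known sent t i j e) :
    known t i ⊆ sentSet sent t i j := by
  intro e he
  by_contra hne
  exact hidle e ⟨he, fun l hl hs => hne (mem_sentSet.2 ⟨l, hl, hs⟩), trivial⟩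

theorem le_card_sentSet_add_or_subset (h : (Protocol.directed : Protocol G).IsRun S known sent)
    (hij : G.Adj i j) {s : ℕ} {A : Set α} (hA : ∀ u, u + 1 ≤ #(known u i) + s ∨ A ⊆ known u i)
    (t : ℕ) : t ≤ #(sentSet sent t i j) + s ∨ A ⊆ sentSet sent t i j := by
  rcases h.le_card_sentSet_or_exists_idle hij t with ht | ⟨u, hut, hcard, hidle⟩
  · exact .inl (by omega)
  · have hsub := known_subset_sentSet_of_idle hidle
    rcases hA u with hu | hu
    · have := Finset.card_le_card hsub
      exact .inl (by omega)
    · exact .inr fun e he => sentSet_mono sent i j hut.le (hsub (hu he))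

theorem le_card_known_add_or_mem_known
    (h : (Protocol.directed : Protocol G).IsRun S known sent) (s t : ℕ) (i : Fin n) :
    t + 1 ≤ #(known t i) + s ∨ S '' {l | ∃ u ≤ s, HasPath G u l i} ⊆ known t i := by
  induction s generalizing t i with
  | zero =>
    right
    rintro _ ⟨l, ⟨u, hu, hp⟩, rfl⟩
    obtain rfl : u = 0 := by omega
    obtain rfl : l = i := hp
    exact h.own_mem_known t l
  | succ s ih =>
    by_cases hfull : ∃ j, t ≤ #(sentSet sent t j i) + s
    · obtain ⟨j, hj⟩ := hfull
      have := Finset.card_le_card (h.sentSet_subset_known t j i)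
      exact .inl (by omega)
    · push Not at hfull
      right
      rintro _ ⟨l, ⟨_ | u, hu, hp⟩, rfl⟩
      · obtain rfl : l = i := hp
        exact h.own_mem_known t l
      · obtain ⟨j, hlj, hji⟩ := hp
        have hsub := (h.le_card_sentSet_add_or_subset hji (fun u => ih u j) t).resolve_left
          (not_le.2 (hfull j))
        exact h.sentSet_subset_known t j i
          (hsub (Set.mem_image_of_mem S ⟨u, by omega, hlj⟩))

theorem mem_known_of_directed (h : (Protocol.directed : Protocol G).IsRun S known sent)
    (hG : StronglyConnected G) (i l : Fin n) : S l ∈ known (n + diameter G - 1) i := by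
  have hn : 0 < n := i.pos
  rcases h.le_card_known_add_or_mem_known (diameter G) (n + diameter G - 1) i with hc | hc
  · exact h.mem_known_of_le_card (by omega) l
  · have hdist : distance G l i ≤ diameter G :=
      Finset.le_sup (f := fun ij : Fin n × Fin n => distance G ij.1 ij.2) (Finset.mem_univ (l, i))
    exact hc (Set.mem_image_of_mem S ⟨distance G l i, hdist, Nat.sInf_mem (hG l i)⟩)

end Directed

end Protocol.IsRun

/-! #### Flooding along a spanning tree -/

theorem exists_adj_dist_lt {V : Type*} {T : SimpleGraph V} (hT : T.Connected) {v x : V}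
    (hvx : v ≠ x) : ∃ y, T.Adj y x ∧ T.dist v y < T.dist v x := by
  obtain ⟨q, hq⟩ := hT.exists_walk_length_eq_dist v x
  have hnil : ¬ q.Nil := fun hn => hvx hn.eq
  refine ⟨q.penultimate, q.adj_penultimate hnil, ?_⟩
  have hdrop := T.dist_le q.dropLast
  have hpos : 0 < T.dist v x := hT.pos_dist_of_ne hvx
  simp only [SimpleGraph.Walk.length_dropLast] at hdrop
  omega

theorem exists_isPath_penultimate_eq {V : Type*} {T : SimpleGraph V} (hT : T.Connected)
    {v x y : V} (hy : T.Adj y x) (hlt : T.dist v y < T.dist v x) :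
    ∃ q : T.Walk v x, q.IsPath ∧ q.penultimate = y := by
  obtain ⟨q, hq⟩ := hT.exists_walk_length_eq_dist v y
  refine ⟨q.concat hy, SimpleGraph.Walk.isPath_of_length_eq_dist _ ?_, by simp⟩
  have := T.dist_le (q.concat hy)
  rw [SimpleGraph.Walk.length_concat] at this ⊢
  omega

theorem eq_of_adj_of_dist_lt {V : Type*} {T : SimpleGraph V} (hT : T.IsTree) {v x y z : V}
    (hy : T.Adj y x) (hz : T.Adj z x) (hyx : T.dist v y < T.dist v x)
    (hzx : T.dist v z < T.dist v x) : y = z := by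
  obtain ⟨q, hq, rfl⟩ := exists_isPath_penultimate_eq hT.1 hy hyx
  obtain ⟨q', hq', rfl⟩ := exists_isPath_penultimate_eq hT.1 hz hzx
  rw [(hT.existsUnique_path v x).unique hq hq']

namespace Protocol.IsRun

section Undirected

variable {T : SimpleGraph (Fin n)} {symm : ∀ i j, G.Adj i j → G.Adj j i}
  {spanning : ∀ i j, T.Adj i j → G.Adj i j} {tree : T.IsTree} {S : Fin n → α}
  {known : ℕ → Fin n → Finset α}

theorem dist_lt_of_mem_sentSet
    (h : (Protocol.undirected T symm spanning tree).IsRun S known sent)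
    (hS : Function.Injective S) (hl : S l ∈ sentSet sent t i j) :
    T.dist l i < T.dist l j := by
  obtain ⟨t, -, hs⟩ := mem_sentSet.1 hl
  clear hl
  induction t using Nat.strong_induction_on generalizing i j with
  | _ t ih =>
    obtain ⟨hij : T.Adj i j, hknown, -, hback⟩ := h.sends_eligible t i j _ hs
    rcases h.mem_known_iff.1 hknown with he | ⟨k, hk⟩
    · obtain rfl := hS he
      rw [SimpleGraph.dist_self]
      exact tree.1.pos_dist_of_ne hij.ne
    · obtain ⟨u, hu, hsu⟩ := mem_sentSet.1 hk
      have hki : T.Adj k i := (h.sends_eligible u k i _ hsu).1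
      have hkj : k ≠ j := by
        rintro rfl
        exact hback u hu hsu
      by_contra hlt
      have hne := tree.dist_ne_of_adj l hij
      exact hkj (eq_of_adj_of_dist_lt tree hki hij.symm (ih u hu hsu) (by omega))

theorem own_notMem_sentSet (h : (Protocol.undirected T symm spanning tree).IsRun S known sent)
    (hS : Function.Injective S) (t : ℕ) (k i : Fin n) : S i ∉ sentSet sent t k i := fun hi => by
  simpa using h.dist_lt_of_mem_sentSet hS hi

theorem mem_sentSet_of_idle
    (hidle : ∀ e, ¬ (Protocol.undirected T symm spanning tree).Eligible known sent t i j e)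
    (he : e ∈ known t i) (hback : e ∉ sentSet sent t j i) : e ∈ sentSet sent t i j := by
  by_contra hne
  exact hidle e ⟨he, fun l hl hs => hne (mem_sentSet.2 ⟨l, hl, hs⟩),
    fun l hl hs => hback (mem_sentSet.2 ⟨l, hl, hs⟩)⟩

theorem sentSet_subset_sentSet_of_idle
    (h : (Protocol.undirected T symm spanning tree).IsRun S known sent)
    (hS : Function.Injective S)
    (hidle : ∀ e, ¬ (Protocol.undirected T symm spanning tree).Eligible known sent t i j e)
    (hij : T.Adj i j) (hki : T.Adj k i) (hkj : k ≠ j) :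
    sentSet sent t k i ⊆ sentSet sent t i j := by
  intro e he
  have hknown := h.sentSet_subset_known t k i he
  obtain ⟨l, rfl⟩ := h.exists_eq_of_mem_known hknown
  exact mem_sentSet_of_idle hidle hknown fun hback =>
    hkj (eq_of_adj_of_dist_lt tree hki hij.symm (h.dist_lt_of_mem_sentSet hS he)
      (h.dist_lt_of_mem_sentSet hS hback))

theorem le_card_sentSet_or_mem_sentSet
    (h : (Protocol.undirected T symm spanning tree).IsRun S known sent)
    (hS : Function.Injective S) (hij : T.Adj i j) (t : ℕ) :
    t ≤ #(sentSet sent t i j) ∨ ∀ l, T.dist l i < T.dist l j → S l ∈ sentSet sent t i j := by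
  classical
  induction t using Nat.strong_induction_on generalizing i j with
  | _ t ih =>
    rcases h.le_card_sentSet_or_exists_idle (show Protocol.Link _ i j from hij) t with
      ht | ⟨u, hut, hcard, hidle⟩
    · exact .inl ht
    have hown : S i ∈ sentSet sent u i j :=
      mem_sentSet_of_idle hidle (h.own_mem_known u i) (h.own_notMem_sentSet hS u j i)
    by_cases hfull : ∃ k, T.Adj k i ∧ k ≠ j ∧ u ≤ #(sentSet sent u k i)
    · obtain ⟨k, hki, hkj, hku⟩ := hfull
      have hle := Finset.card_le_card (Finset.insert_subset hown
        (h.sentSet_subset_sentSet_of_idle hS hidle hij hki hkj))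
      rw [Finset.card_insert_of_notMem (h.own_notMem_sentSet hS u k i)] at hle
      exact .inl (by omega)
    · refine .inr fun l hl => sentSet_mono sent i j hut.le ?_
      obtain rfl | hli := eq_or_ne l i
      · exact hown
      obtain ⟨k, hki, hlk⟩ := exists_adj_dist_lt tree.1 hli
      have hkj : k ≠ j := by
        rintro rfl
        exact hl.not_gt hlk
      have hmem := (ih u hut hki).resolve_left fun hku => hfull ⟨k, hki, hkj, hku⟩
      exact h.sentSet_subset_sentSet_of_idle hS hidle hij hki hkj (hmem l hlk)

theorem mem_known_of_undirected
    (h : (Protocol.undirected T symm spanning tree).IsRun S known sent)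
    (hS : Function.Injective S) (i l : Fin n) : S l ∈ known (n - 1) i := by
  classical
  obtain rfl | hli := eq_or_ne l i
  · exact h.own_mem_known _ _
  obtain ⟨k, hk, hlk⟩ := exists_adj_dist_lt tree.1 hli
  have hsub := h.sentSet_subset_known (n - 1) k i
  rcases h.le_card_sentSet_or_mem_sentSet hS hk (n - 1) with hc | hc
  · have hle := Finset.card_le_card (Finset.insert_subset (h.own_mem_known (n - 1) i) hsub)
    rw [Finset.card_insert_of_notMem (h.own_notMem_sentSet hS _ k i)] at hle
    exact h.mem_known_of_le_card (by omega) l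
  · exact hsub (hc l hlk)

end Undirected

variable {P : Protocol G} {S : Fin n → α} {known : ℕ → Fin n → Finset α}

theorem mem_known_rounds (h : P.IsRun S known sent) (hS : Function.Injective S)
    (hG : StronglyConnected G) (i l : Fin n) : S l ∈ known P.rounds i := by
  cases P with
  | undirected T symm spanning tree => exact h.mem_known_of_undirected hS i l
  | directed => exact h.mem_known_of_directed hG i l

theorem sum_known_rounds (h : P.IsRun S known sent) (hS : Function.Injective S)
    (hG : StronglyConnected G) {E : Type*} [AddCommMonoid E] (ψ : α → E) (i : Fin n) :
    ∑ m ∈ known P.rounds i, ψ m = ∑ l, ψ (S l) := by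
  classical
  have hknown : known P.rounds i = Finset.univ.image S := by
    ext e
    refine ⟨fun he => by simpa using h.exists_eq_of_mem_known he, fun he => ?_⟩
    obtain ⟨l, -, rfl⟩ := Finset.mem_image.1 he
    exact h.mem_known_rounds hS hG i l
  rw [hknown, Finset.sum_image hS.injOn]

end Protocol.IsRun

end Flooding

/-! ### Deflation -/

section Deflation

open scoped Finset

variable {𝕜 E ι : Type*} [RCLike 𝕜] [NormedAddCommGroup E] [InnerProductSpace 𝕜 E] [Fintype ι]
  {A : E →L[𝕜] E}

section Eigenbasis

variable {lam : ι → 𝕜} {w : OrthonormalBasis ι 𝕜 E}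

theorem inner_apply_of_eigenbasis (hA : ∀ j, A (w j) = lam j • w j) (v : E) (j : ι) :
    inner 𝕜 (w j) (A v) = lam j * inner 𝕜 (w j) v := by
  have hv : A v = ∑ i, (inner 𝕜 (w i) v * lam i) • w i := by
    conv_lhs => rw [← w.sum_repr' v]
    simp only [map_sum, map_smul, hA, smul_smul]
  rw [hv, w.orthonormal.inner_right_fintype, mul_comm]

theorem norm_sq_apply_of_eigenbasis (hA : ∀ j, A (w j) = lam j • w j) (v : E) :
    ‖A v‖ ^ 2 = ∑ j, ‖lam j‖ ^ 2 * ‖inner 𝕜 (w j) v‖ ^ 2 := by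
  simp only [← w.sum_sq_norm_inner_right (A v), inner_apply_of_eigenbasis hA, norm_mul, mul_pow]

theorem norm_apply_le_of_eigenbasis (hA : ∀ j, A (w j) = lam j • w j) {c : ℝ} (hc : 0 ≤ c)
    {v : E} (h : ∀ j, ‖lam j‖ ≤ c ∨ inner 𝕜 (w j) v = 0) : ‖A v‖ ≤ c * ‖v‖ := by
  refine le_of_sq_le_sq ?_ (by positivity)
  rw [norm_sq_apply_of_eigenbasis hA, mul_pow, ← w.sum_sq_norm_inner_right v, Finset.mul_sum]
  refine Finset.sum_le_sum fun j _ => ?_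
  rcases h j with hj | hj
  · gcongr
  · simp [hj]

theorem mul_norm_le_norm_apply_of_eigenbasis (hA : ∀ j, A (w j) = lam j • w j) {c : ℝ}
    {v : E} (h : ∀ j, c ≤ ‖lam j‖ ∨ inner 𝕜 (w j) v = 0) (hc : 0 ≤ c) : c * ‖v‖ ≤ ‖A v‖ := by
  refine le_of_sq_le_sq ?_ (norm_nonneg _)
  rw [norm_sq_apply_of_eigenbasis hA, mul_pow, ← w.sum_sq_norm_inner_right v, Finset.mul_sum]
  refine Finset.sum_le_sum fun j _ => ?_
  rcases h j with hj | hj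
  · gcongr
  · simp [hj]

end Eigenbasis

theorem finrank_orthogonal_span_image (w : OrthonormalBasis ι 𝕜 E) (J : Finset ι) :
    Module.finrank 𝕜 (Submodule.span 𝕜 (w '' J))ᗮ + #J = Fintype.card ι := by
  have := w.toBasis.finiteDimensional_of_finite
  have hli : LinearIndependent 𝕜 fun j : J => w j :=
    w.orthonormal.linearIndependent.comp _ Subtype.val_injective
  have hJ : Module.finrank 𝕜 (Submodule.span 𝕜 (w '' J)) = #J := by
    rw [Set.image_eq_range]
    exact (finrank_span_eq_card hli).trans (Fintype.card_coe J)
  rw [← hJ, add_comm, Submodule.finrank_add_finrank_orthogonal,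
    Module.finrank_eq_card_basis w.toBasis]

/-- The `m`-th Gelfand number of `A` is at most `ε`: the operator `A` is bounded by `ε` on a
subspace of codimension at most `m`. A rank-one deflation of `A` lowers `m` by one, and a
perturbation of `A` by `D` raises `ε` by `‖D‖`. -/
def BoundedOnCodim (m : ℕ) (ε : ℝ) (A : E →L[𝕜] E) : Prop :=
  ∃ W : Submodule 𝕜 E, Module.finrank 𝕜 E ≤ Module.finrank 𝕜 W + m ∧ ∀ v ∈ W, ‖A v‖ ≤ ε * ‖v‖

theorem boundedOnCodim_finrank (A : E →L[𝕜] E) : BoundedOnCodim (Module.finrank 𝕜 E) 0 A :=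
  ⟨⊥, by simp, fun v hv => by simp [(Submodule.mem_bot 𝕜).1 hv]⟩

namespace BoundedOnCodim

variable {m : ℕ} {ε : ℝ}

theorem add (h : BoundedOnCodim m ε A) (D : E →L[𝕜] E) :
    BoundedOnCodim m (ε + ‖D‖) (A + D) := by
  obtain ⟨W, hW, hA⟩ := h
  refine ⟨W, hW, fun v hv => ?_⟩
  rw [add_mul, add_apply]
  exact (norm_add_le _ _).trans (add_le_add (hA v hv) (D.le_opNorm v))

theorem opNorm_le [FiniteDimensional 𝕜 E] (h : BoundedOnCodim 0 ε A) (hε : 0 ≤ ε) : ‖A‖ ≤ ε := by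
  obtain ⟨W, hW, hA⟩ := h
  obtain rfl : W = ⊤ := Submodule.eq_top_of_finrank_eq (W.finrank_le.antisymm hW)
  exact A.opNorm_le_bound hε fun v => hA v Submodule.mem_top

variable {p : ℕ} {lam : Fin p → 𝕜} {w : OrthonormalBasis (Fin p) 𝕜 E}

theorem norm_eigenvalue_le (h : BoundedOnCodim m ε A) (hA : ∀ j, A (w j) = lam j • w j)
    (hlam : Antitone fun j => ‖lam j‖) {j : Fin p} (hj : m ≤ j) : ‖lam j‖ ≤ ε := by
  have := w.toBasis.finiteDimensional_of_finite
  obtain ⟨W, hW, hbound⟩ := h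
  set V : Submodule 𝕜 E := (Submodule.span 𝕜 (w '' (Finset.Ioi j : Finset (Fin p))))ᗮ
  obtain ⟨v, hvW, hvV, hv⟩ : ∃ v ∈ W, v ∈ V ∧ v ≠ 0 := by
    by_contra! hcon
    have hdim := Submodule.finrank_add_finrank_le_of_disjoint (Submodule.disjoint_def.2 hcon)
    have hV : Module.finrank 𝕜 V + (p - 1 - j) = p := by
      simpa using finrank_orthogonal_span_image w (Finset.Ioi j)
    have hE : Module.finrank 𝕜 E = p := by simp [Module.finrank_eq_card_basis w.toBasis]
    omega
  have hlow : ‖lam j‖ * ‖v‖ ≤ ‖A v‖ := by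
    refine mul_norm_le_norm_apply_of_eigenbasis hA (fun i => ?_) (norm_nonneg _)
    refine (le_or_gt i j).imp (fun hij => hlam hij) fun hij => ?_
    exact Submodule.inner_right_of_mem_orthogonal (Submodule.subset_span
      (Set.mem_image_of_mem w (Finset.mem_coe.2 (Finset.mem_Ioi.2 hij)))) hvV
  exact le_of_mul_le_mul_right (hlow.trans (hbound v hvW)) (norm_pos_iff.2 hv)

theorem deflate [NeZero p] (h : BoundedOnCodim m ε A) (hε : 0 ≤ ε)
    (hA : ∀ j, A (w j) = lam j • w j) (hlam : Antitone fun j => ‖lam j‖) {A' : E →L[𝕜] E}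
    (hA' : ∀ j, A' (w j) = (if j = 0 then 0 else lam j) • w j) :
    BoundedOnCodim (m - 1) ε A' := by
  set J : Finset (Fin p) := {j | (j : ℕ) ∈ Finset.Ico 1 m} with hJ
  have hcard : #J ≤ m - 1 := by
    rw [← Nat.card_Ico 1 m]
    exact Finset.card_le_card_of_injOn Fin.val (fun j hj => (Finset.mem_filter.1 hj).2)
      Fin.val_injective.injOn
  refine ⟨(Submodule.span 𝕜 (w '' J))ᗮ, ?_, fun v hv => ?_⟩
  · have := finrank_orthogonal_span_image w J
    rw [Module.finrank_eq_card_basis w.toBasis]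
    omega
  · refine norm_apply_le_of_eigenbasis hA' hε fun j => ?_
    obtain rfl | hj := eq_or_ne j 0
    · simp [hε]
    rw [if_neg hj]
    rcases le_or_gt m j with hmj | hjm
    · exact .inl (h.norm_eigenvalue_le hA hlam hmj)
    · have hjJ : j ∈ J := by simpa [hJ, Nat.one_le_iff_ne_zero, hj] using hjm
      exact .inr (Submodule.inner_right_of_mem_orthogonal
        (Submodule.subset_span (Set.mem_image_of_mem w hjJ)) hv)

end BoundedOnCodim

end Deflation

section RankOne

variable {p : ℕ}

local notation "𝔼" => EuclideanSpace ℝ (Fin p)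

theorem signedOuter_sign_sqrt_smul (a : ℝ) (v : 𝔼) :
    signedOuter (Real.sign a) (√|a| • v) = a • InnerProductSpace.rankOne ℝ v v := by
  have hsign : Real.sign a * |a| = a := by
    rcases lt_trichotomy a 0 with h | rfl | h
    · rw [Real.sign_of_neg h, abs_of_neg h, neg_one_mul, neg_neg]
    · simp
    · rw [Real.sign_of_pos h, abs_of_pos h, one_mul]
  have hsqrt : √|a| * √|a| = |a| := Real.mul_self_sqrt (abs_nonneg a)
  ext1 u
  simp only [signedOuter, smul_apply, InnerProductSpace.rankOne_apply, real_inner_smul_left,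
    smul_smul]
  congr 1
  linear_combination (Real.sign a * inner ℝ v u) * hsqrt + inner ℝ v u * hsign

variable [NeZero p]

theorem sub_signedOuter_apply {A : 𝔼 →L[ℝ] 𝔼} {lam : Fin p → ℝ}
    {w : OrthonormalBasis (Fin p) ℝ 𝔼} (hA : ∀ j, A (w j) = lam j • w j) (j : Fin p) :
    (A - signedOuter (Real.sign (lam 0)) (√|lam 0| • w 0)) (w j) =
      (if j = 0 then 0 else lam j) • w j := by
  rw [signedOuter_sign_sqrt_smul, sub_apply, hA, smul_apply, InnerProductSpace.rankOne_apply,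
    orthonormal_iff_ite.1 w.orthonormal]
  obtain rfl | hj := eq_or_ne j 0
  · simp
  · simp [hj, hj.symm]

namespace IsRankOneApprox

theorem norm_sub_eq {A : 𝔼 →L[ℝ] 𝔼} {s r : ℝ} {h : 𝔼} (hap : IsRankOneApprox A s h r) :
    ‖A - signedOuter s h‖ = r := by
  obtain ⟨lam, w, hA, hlam, rfl, rfl, rfl⟩ := hap
  have hdefl := sub_signedOuter_apply hA
  apply le_antisymm
  · have hr : 0 ≤ if hp : 1 < p then |lam ⟨1, hp⟩| else 0 := by split_ifs <;> positivity
    refine ContinuousLinearMap.opNorm_le_bound _ hr fun v =>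
      norm_apply_le_of_eigenbasis hdefl hr fun j => .inl ?_
    obtain rfl | hj := eq_or_ne j 0
    · simpa using hr
    · have hj1 : 1 ≤ (j : ℕ) := Nat.one_le_iff_ne_zero.2 (Fin.val_ne_zero_iff.2 hj)
      rw [if_neg hj, dif_pos (hj1.trans_lt j.isLt)]
      exact hlam (Fin.le_def.2 hj1)
  · split_ifs with hp
    · have hone : (⟨1, hp⟩ : Fin p) ≠ 0 := fun h0 => by simpa using congrArg Fin.val h0
      simpa [hdefl, hone, norm_smul] using
        (A - signedOuter (Real.sign (lam 0)) (√|lam 0| • w 0)).le_opNorm (w ⟨1, hp⟩)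
    · exact norm_nonneg _

theorem boundedOnCodim_sub {A : 𝔼 →L[ℝ] 𝔼} {s r : ℝ} {h : 𝔼} (hap : IsRankOneApprox A s h r)
    {m : ℕ} {ε : ℝ} (hm : BoundedOnCodim m ε A) (hε : 0 ≤ ε) :
    BoundedOnCodim (m - 1) ε (A - signedOuter s h) := by
  obtain ⟨lam, w, hA, hlam, rfl, rfl, -⟩ := hap
  exact hm.deflate hε hA hlam (sub_signedOuter_apply hA)

theorem remainder_le_sum_drift {A D : ℕ → 𝔼 →L[ℝ] 𝔼} {s r : ℕ → ℝ} {h : ℕ → 𝔼}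
    (hap : ∀ k, IsRankOneApprox (A k) (s k) (h k) (r k))
    (hA : ∀ k, A (k + 1) = A k - signedOuter (s k) (h k) + D k) (k : ℕ) :
    r (k + p) ≤ ∑ l ∈ Finset.range p, ‖D (k + l)‖ := by
  have hcodim : ∀ m, BoundedOnCodim (p - m) (∑ l ∈ Finset.range m, ‖D (k + l)‖)
      (A (k + m) - signedOuter (s (k + m)) (h (k + m))) := by
    intro m
    induction m with
    | zero => simpa using boundedOnCodim_finrank (A k - signedOuter (s k) (h k))
    | succ m ih =>
      rw [Finset.sum_range_succ, ← Nat.sub_sub]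
      refine (hap (k + (m + 1))).boundedOnCodim_sub ?_ (by positivity)
      rw [← add_assoc, hA]
      exact ih.add _
  have hp := hcodim p
  rw [Nat.sub_self] at hp
  exact (hap (k + p)).norm_sub_eq ▸ hp.opNorm_le (by positivity)

end IsRankOneApprox

end RankOne

/-! ### Strong monotonicity -/

section Segments

variable {E F : Type*} [NormedAddCommGroup E] [NormedSpace ℝ E] [NormedAddCommGroup F]
  [NormedSpace ℝ F]

theorem hasDerivAt_comp_add_smul {f : E → F} {f' : E →L[ℝ] F} {x d : E} {t : ℝ}
    (hf : HasFDerivAt f f' (x + t • d)) :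
    HasDerivAt (fun t : ℝ => f (x + t • d)) (f' d) t := by
  have hline : HasDerivAt (fun t : ℝ => x + t • d) d t := by
    simpa using ((hasDerivAt_id t).smul_const d).const_add x
  exact hf.comp_hasDerivAt t hline

theorem norm_sub_sub_fderiv_le_of_lipschitz {f : E → F} {f' : E → E →L[ℝ] F}
    (hf : ∀ x, HasFDerivAt f (f' x) x) {L : ℝ} (hL : ∀ x y, ‖f' x - f' y‖ ≤ L * ‖x - y‖)
    (x d : E) : ‖f (x + d) - f x - f' x d‖ ≤ L / 2 * ‖d‖ ^ 2 := by
  have hrem : ∀ t : ℝ, HasDerivAt (fun t : ℝ => f (x + t • d) - f x - t • f' x d)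
      ((f' (x + t • d) - f' x) d) t := fun t => by
    simpa using ((hasDerivAt_comp_add_smul (hf _)).sub_const (f x)).fun_sub
      ((hasDerivAt_id t).smul_const (f' x d))
  have hbound : ∀ t : ℝ, HasDerivAt (fun t : ℝ => L / 2 * ‖d‖ ^ 2 * t ^ 2) (L * ‖d‖ ^ 2 * t) t :=
    fun t => ((hasDerivAt_pow 2 t).const_mul (L / 2 * ‖d‖ ^ 2)).congr_deriv (by push_cast; ring)
  have hle : ∀ t ∈ Set.Ico (0 : ℝ) 1, ‖(f' (x + t • d) - f' x) d‖ ≤ L * ‖d‖ ^ 2 * t := fun t ht =>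
    calc ‖(f' (x + t • d) - f' x) d‖ ≤ L * ‖x + t • d - x‖ * ‖d‖ :=
          (f' (x + t • d) - f' x).le_of_opNorm_le (hL _ _) d
      _ = L * ‖d‖ ^ 2 * t := by
        rw [add_sub_cancel_left, norm_smul, Real.norm_of_nonneg ht.1]
        ring
  simpa using image_norm_le_of_norm_deriv_right_le_deriv_boundary
    (fun t _ => (hrem t).continuousAt.continuousWithinAt)
    (fun t _ => (hrem t).hasDerivWithinAt) (by simp) hbound hle (Set.right_mem_Icc.2 zero_le_one)

end Segments

section StronglyMonotone

variable {E : Type*} [NormedAddCommGroup E] [InnerProductSpace ℝ E] {μ : ℝ}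

/-- The map `g` is strongly monotone with modulus `μ`. For the gradient of a function this is strong
convexity of the function, and for a linear operator it is coercivity. -/
def StronglyMonotone (μ : ℝ) (g : E → E) : Prop :=
  ∀ x y, μ * ‖x - y‖ ^ 2 ≤ inner ℝ (g x - g y) (x - y)

theorem stronglyMonotone_iff {A : E →L[ℝ] E} :
    StronglyMonotone μ A ↔ ∀ v, μ * ‖v‖ ^ 2 ≤ inner ℝ (A v) v := by
  refine ⟨fun h v => by simpa using h v 0, fun h x y => ?_⟩
  rw [← map_sub]
  exact h (x - y)

namespace StronglyMonotone

variable {g : E → E}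

theorem of_hasFDerivAt {J : E → E →L[ℝ] E} (hg : ∀ x, HasFDerivAt g (J x) x)
    (hJ : ∀ x, StronglyMonotone μ (J x)) : StronglyMonotone μ g := by
  intro x y
  set d := x - y with hd
  have hderiv : ∀ t : ℝ, HasDerivAt (fun t : ℝ => inner ℝ (g (y + t • d)) d - t * (μ * ‖d‖ ^ 2))
      (inner ℝ (J (y + t • d) d) d - μ * ‖d‖ ^ 2) t := fun t => by
    simpa using ((hasDerivAt_comp_add_smul (hg _)).inner ℝ (hasDerivAt_const t d)).fun_sub
      ((hasDerivAt_id t).mul_const (μ * ‖d‖ ^ 2))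
  have hmono := monotone_of_hasDerivAt_nonneg hderiv
    (fun t => sub_nonneg.2 (stronglyMonotone_iff.1 (hJ _) d)) zero_le_one
  simp only [zero_smul, add_zero, zero_mul, sub_zero, one_smul, one_mul, hd,
    add_sub_cancel] at hmono
  rw [inner_sub_left]
  linarith

theorem norm_sub_le (hg : StronglyMonotone μ g) (hμ : 0 < μ) (x y : E) :
    ‖x - y‖ ≤ ‖g x - g y‖ / μ := by
  rw [le_div_iff₀' hμ]
  rcases (norm_nonneg (x - y)).eq_or_lt with h | h
  · simp [← h]
  · refine le_of_mul_le_mul_right ?_ h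
    linarith [(hg x y).trans (real_inner_le_norm _ _)]

theorem add_inner_add_le [CompleteSpace E] (hg : StronglyMonotone μ g) {F : E → ℝ}
    (hF : ∀ x, HasGradientAt F (g x) x) (x d : E) :
    F x + inner ℝ (g x) d + μ / 2 * ‖d‖ ^ 2 ≤ F (x + d) := by
  have hderiv : ∀ t : ℝ, HasDerivAt
      (fun t : ℝ => F (x + t • d) - t * inner ℝ (g x) d - μ / 2 * ‖d‖ ^ 2 * t ^ 2)
      (inner ℝ (g (x + t • d) - g x) d - μ * ‖d‖ ^ 2 * t) t := fun t => by
    have hline := hasDerivAt_comp_add_smul (hF (x + t • d)).hasFDerivAt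
    refine ((hline.fun_sub ((hasDerivAt_id t).mul_const (inner ℝ (g x) d))).fun_sub
      ((hasDerivAt_pow 2 t).const_mul (μ / 2 * ‖d‖ ^ 2))).congr_deriv ?_
    rw [inner_sub_left, InnerProductSpace.toDual_apply_apply]
    push_cast
    ring
  have hnonneg : ∀ t ∈ interior (Set.Icc (0 : ℝ) 1),
      0 ≤ inner ℝ (g (x + t • d) - g x) d - μ * ‖d‖ ^ 2 * t := fun t ht => by
    rw [interior_Icc] at ht
    have h := hg (x + t • d) x
    rw [add_sub_cancel_left, norm_smul, Real.norm_of_nonneg ht.1.le, inner_smul_right] at h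
    refine sub_nonneg.2 (le_of_mul_le_mul_left ?_ ht.1)
    linarith
  have hmono := monotoneOn_of_hasDerivWithinAt_nonneg (convex_Icc 0 1)
    (fun t _ => (hderiv t).continuousAt.continuousWithinAt)
    (fun t _ => (hderiv t).hasDerivWithinAt) hnonneg (Set.left_mem_Icc.2 zero_le_one)
    (Set.right_mem_Icc.2 zero_le_one) zero_le_one
  norm_num at hmono
  linarith

theorem isBounded_setOf_le [CompleteSpace E] (hg : StronglyMonotone μ g) (hμ : 0 < μ) {F : E → ℝ}
    (hF : ∀ x, HasGradientAt F (g x) x) (x : E) : Bornology.IsBounded {y | F y ≤ F x} := by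
  refine (Metric.isBounded_closedBall (x := x) (r := ‖g x‖ / (μ / 2))).subset
    fun y (hy : F y ≤ F x) => ?_
  rw [mem_closedBall_iff_norm, le_div_iff₀' (half_pos hμ)]
  rcases (norm_nonneg (y - x)).eq_or_lt with h | h
  · simp [← h]
  · refine le_of_mul_le_mul_right ?_ h
    have hgrowth := hg.add_inner_add_le hF x (y - x)
    rw [add_sub_cancel] at hgrowth
    linarith [neg_le_of_abs_le (abs_real_inner_le_norm (g x) (y - x))]

theorem lt_of_ne [CompleteSpace E] (hg : StronglyMonotone μ g) (hμ : 0 < μ) {F : E → ℝ}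
    (hF : ∀ x, HasGradientAt F (g x) x) {x y : E} (hx : g x = 0) (hxy : y ≠ x) : F x < F y := by
  have hgrowth := hg.add_inner_add_le hF x (y - x)
  rw [hx, inner_zero_left, add_zero, add_sub_cancel] at hgrowth
  have hpos : 0 < ‖y - x‖ := norm_pos_iff.2 (sub_ne_zero.2 hxy)
  have : 0 < μ / 2 * ‖y - x‖ ^ 2 := by positivity
  linarith

theorem exists_eq_zero [ProperSpace E] (hg : StronglyMonotone μ g) (hμ : 0 < μ) {F : E → ℝ}
    (hF : ∀ x, HasGradientAt F (g x) x) : ∃ x, g x = 0 := by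
  have hcont : Continuous F :=
    continuous_iff_continuousAt.2 fun x => (hF x).hasFDerivAt.continuousAt
  obtain ⟨x, hx⟩ := hcont.exists_forall_le_of_isBounded 0 (hg.isBounded_setOf_le hμ hF 0)
  have hmin : IsLocalMin F x := .of_forall hx
  exact ⟨x, by simpa using hmin.hasFDerivAt_eq_zero (hF x).hasFDerivAt⟩

variable {A B : E →L[ℝ] E} {r : ℝ}

theorem of_opNorm_sub_le (hA : StronglyMonotone μ A) (hAB : ‖A - B‖ ≤ r) :
    StronglyMonotone (μ - r) B := by
  refine stronglyMonotone_iff.2 fun v => ?_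
  have hdiff : inner ℝ ((A - B) v) v ≤ r * ‖v‖ * ‖v‖ := (real_inner_le_norm _ _).trans
    (mul_le_mul_of_nonneg_right ((A - B).le_of_opNorm_le hAB v) (norm_nonneg v))
  rw [sub_apply, inner_sub_left] at hdiff
  linarith [stronglyMonotone_iff.1 hA v]

variable [CompleteSpace E]

theorem apply_inverse (hB : StronglyMonotone μ B) (hμ : 0 < μ) (y : E) :
    B (B.inverse y) = y := by
  have hunit : IsUnit B := B.isUnit_of_forall_le_norm_inner_map (c := ⟨μ, hμ.le⟩) hμ fun v => by
    rw [mul_comm]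
    exact (stronglyMonotone_iff.1 hB v).trans (le_abs_self _)
  have hinv : B.IsInvertible := ⟨ContinuousLinearEquiv.ofUnit hunit.unit, rfl⟩
  exact hinv.self_apply_inverse y

theorem norm_inverse_apply_le (hB : StronglyMonotone μ B) (hμ : 0 < μ) (y : E) :
    ‖B.inverse y‖ ≤ ‖y‖ / μ := by
  simpa [hB.apply_inverse hμ] using hB.norm_sub_le hμ (B.inverse y) 0

end StronglyMonotone

end StronglyMonotone

section Hessian

section Gradient

variable {E ι : Type*} [NormedAddCommGroup E] [InnerProductSpace ℝ E] [CompleteSpace E]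

theorem gradient_sum {s : Finset ι} {f : ι → E → ℝ} {x : E}
    (hf : ∀ i ∈ s, DifferentiableAt ℝ (f i) x) :
    gradient (fun y => ∑ i ∈ s, f i y) x = ∑ i ∈ s, gradient (f i) x := by
  simp only [gradient, fderiv_fun_sum hf, map_sum]

theorem contDiff_gradient {F : E → ℝ} {k m : WithTop ℕ∞} (hF : ContDiff ℝ k F) (hm : m + 1 ≤ k) :
    ContDiff ℝ m (gradient F) :=
  (InnerProductSpace.toDual ℝ E).symm.contDiff.comp (hF.fderiv_right hm)

end Gradient

variable {p : ℕ}

local notation "𝔼" => EuclideanSpace ℝ (Fin p)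

theorem hasFDerivAt_gradient {F : 𝔼 → ℝ} (hF : ContDiff ℝ 2 F) (x : 𝔼) :
    HasFDerivAt (gradient F) (hessian F x) x :=
  ((contDiff_gradient hF one_add_one_eq_two.le).differentiable one_ne_zero x).hasFDerivAt

theorem continuous_hessian {F : 𝔼 → ℝ} (hF : ContDiff ℝ 2 F) : Continuous (hessian F) :=
  (contDiff_gradient hF one_add_one_eq_two.le).continuous_fderiv one_ne_zero

theorem hessian_sum {ι : Type*} {s : Finset ι} {f : ι → 𝔼 → ℝ}
    (hf : ∀ i ∈ s, ContDiff ℝ 2 (f i)) (x : 𝔼) :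
    hessian (fun y => ∑ i ∈ s, f i y) x = ∑ i ∈ s, hessian (f i) x := by
  have hgrad : gradient (fun y => ∑ i ∈ s, f i y) = fun y => ∑ i ∈ s, gradient (f i) y :=
    funext fun y => gradient_sum fun i hi => (hf i hi).differentiable two_ne_zero y
  rw [hessian, hgrad]
  exact (HasFDerivAt.fun_sum fun i hi => hasFDerivAt_gradient (hf i hi) x).fderiv

end Hessian

/-! ### Real sequences -/

section Rates

open Filter Topology

theorem tendsto_zero_of_frequently_le_sub {u : ℕ → ℝ} {ψ : ℝ → ℝ} (hu : Antitone u)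
    (hu0 : ∀ k, 0 ≤ u k) (hψ : Continuous ψ) (hψ0 : ∀ x, 0 < x → 0 < ψ x)
    (h : ∃ᶠ k in atTop, u (k + 1) ≤ u k - ψ (u k)) : Tendsto u atTop (𝓝 0) := by
  have hlim := tendsto_atTop_ciInf hu ⟨0, Set.forall_mem_range.2 hu0⟩
  set l := ⨅ k, u k
  have hl : l ≤ l - ψ l := le_of_tendsto_of_tendsto_of_frequently
    (hlim.comp (tendsto_add_atTop_nat 1)) (hlim.sub ((hψ.tendsto l).comp hlim)) h
  obtain hl0 | hl0 := (le_ciInf hu0 : 0 ≤ l).eq_or_lt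
  · rwa [hl0]
  · linarith [hψ0 l hl0]

theorem qSuperlinear_of_tendsto {e : ℕ → ℝ} (he : ∀ k, e k ≠ 0)
    (h : Tendsto (fun k => |e (k + 1)| / |e k|) atTop (𝓝 0)) : QSuperlinear e :=
  ⟨he, (summable_of_ratio_test_tendsto_lt_one zero_lt_one (.of_forall he) h).tendsto_atTop_zero, h⟩

theorem RSuperlinear.of_le {u v : ℕ → ℝ} (hv : RSuperlinear v) (h : ∀ k, |u k| ≤ |v k|) :
    RSuperlinear u :=
  let ⟨e, he, hle⟩ := hv
  ⟨e, he, fun k => (h k).trans (hle k)⟩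

theorem rSuperlinear_of_eventually_le {u b : ℕ → ℝ} (hu : ∀ k, 0 ≤ u k)
    (hb : Tendsto b atTop (𝓝 0)) (hub : ∀ᶠ k in atTop, u (k + 1) ≤ b k * u k) :
    RSuperlinear u := by
  -- The second argument of `max` keeps the terms nonzero when `u` vanishes.
  let e : ℕ → ℝ := fun k => Nat.rec (max (u 0) 1)
    (fun k y => max (u (k + 1)) (1 / ((k : ℝ) + 1) * y)) k
  have hsucc : ∀ k, e (k + 1) = max (u (k + 1)) (1 / ((k : ℝ) + 1) * e k) := fun _ => rfl
  have hpos : ∀ k, 0 < e k := by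
    intro k
    induction k with
    | zero => exact lt_max_of_lt_right one_pos
    | succ k ih => exact lt_max_of_lt_right (by positivity)
  have hle : ∀ k, u k ≤ e k := by
    rintro (_ | k) <;> exact le_max_left _ _
  have hratio : Tendsto (fun k => |e (k + 1)| / |e k|) atTop (𝓝 0) := by
    have hlim : Tendsto (fun k : ℕ => max |b k| (1 / ((k : ℝ) + 1))) atTop (𝓝 0) := by
      simpa using hb.abs.max tendsto_one_div_add_atTop_nhds_zero_nat
    refine squeeze_zero' (.of_forall fun k => by positivity) ?_ hlim
    filter_upwards [hub] with k hk
    rw [abs_of_pos (hpos k), abs_of_pos (hpos (k + 1)), div_le_iff₀ (hpos k), hsucc]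
    refine max_le ?_ (mul_le_mul_of_nonneg_right (le_max_right _ _) (hpos k).le)
    calc u (k + 1) ≤ b k * u k := hk
      _ ≤ |b k| * e k := mul_le_mul (le_abs_self _) (hle k) (hu k) (abs_nonneg _)
      _ ≤ _ := mul_le_mul_of_nonneg_right (le_max_left _ _) (hpos k).le
  refine ⟨e, qSuperlinear_of_tendsto (fun k => (hpos k).ne') hratio, fun k => ?_⟩
  rw [abs_of_nonneg (hu k), abs_of_pos (hpos k)]
  exact hle k

end Rates

/-! ### Inexact Newton methods -/

section InexactNewton

open Filter Topology

variable {E : Type*} [NormedAddCommGroup E] [InnerProductSpace ℝ E]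
  {g : E → E} {J : E → E →L[ℝ] E} {μ L T φ θ : ℝ} {X : ℕ → E} {B : ℕ → E →L[ℝ] E} {ρ a : ℕ → ℝ}

theorem norm_newton_step_le [CompleteSpace E] (hg : ∀ x, HasFDerivAt g (J x) x) (hL0 : 0 ≤ L)
    (hL : ∀ x y, ‖J x - J y‖ ≤ L * ‖x - y‖) {B : E →L[ℝ] E} {m : ℝ} (hm : 0 < m)
    (hB : StronglyMonotone m B) {x : E} {r : ℝ} (hr : ‖J x - B‖ ≤ r) {a : ℝ}
    (ha : a ∈ Set.Icc 0 1) :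
    ‖g (x - a • B.inverse (g x))‖ ≤
      (1 - a) * ‖g x‖ + r * (a * ‖g x‖ / m) + L / 2 * (a * ‖g x‖ / m) ^ 2 := by
  set d := -(a • B.inverse (g x)) with hd
  have hBd : B d = -(a • g x) := by rw [hd, map_neg, map_smul, hB.apply_inverse hm]
  have hnorm : ‖d‖ ≤ a * ‖g x‖ / m := by
    rw [hd, norm_neg, norm_smul, Real.norm_of_nonneg ha.1, mul_div_assoc]
    exact mul_le_mul_of_nonneg_left (hB.norm_inverse_apply_le hm (g x)) ha.1
  have hr0 : 0 ≤ r := (norm_nonneg _).trans hr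
  have hsplit : g (x + d) =
      (1 - a) • g x + (J x - B) d + (g (x + d) - g x - J x d) := by
    rw [sub_apply, hBd]
    module
  rw [sub_eq_add_neg, hsplit]
  calc _ ≤ ‖(1 - a) • g x‖ + ‖(J x - B) d‖ + ‖g (x + d) - g x - J x d‖ := norm_add₃_le
    _ ≤ (1 - a) * ‖g x‖ + r * ‖d‖ + L / 2 * ‖d‖ ^ 2 := by
      gcongr
      · rw [norm_smul, Real.norm_of_nonneg (sub_nonneg.2 ha.2)]
      · exact (J x - B).le_of_opNorm_le hr d
      · exact norm_sub_sub_fderiv_le_of_lipschitz hg hL x d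
    _ ≤ _ := by gcongr

/-- A run `X` of a damped inexact Newton method for the equation `g x = 0`: the operator `B k`
approximates the derivative `J (X k)` of `g` up to an error of at most `ρ k`. The method stands
still while this bound exceeds the threshold `T`, and otherwise the damping factor `a k` truncates
the residual to the length `φ`. -/
structure IsInexactNewton (g : E → E) (J : E → E →L[ℝ] E) (T φ : ℝ) (X : ℕ → E)
    (B : ℕ → E →L[ℝ] E) (ρ a : ℕ → ℝ) : Prop where
  norm_sub_le : ∀ k, ‖J (X k) - B k‖ ≤ ρ k
  succ : ∀ k, X (k + 1) = X k - a k • (B k).inverse (g (X k))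
  mem_Icc : ∀ k, a k ∈ Set.Icc 0 1
  mul_norm_of_le : ∀ k, ρ k ≤ T → a k * ‖g (X k)‖ = min ‖g (X k)‖ φ
  eq_zero_of_lt : ∀ k, T < ρ k → a k = 0

namespace IsInexactNewton

theorem succ_eq_of_lt (h : IsInexactNewton g J T φ X B ρ a) {k : ℕ} (hk : T < ρ k) :
    X (k + 1) = X k := by
  rw [h.succ, h.eq_zero_of_lt k hk, zero_smul, sub_zero]

theorem frequently_le (h : IsInexactNewton g J T φ X B ρ a) (hT0 : 0 < T)
    (hρ : ∀ y, Tendsto X atTop (𝓝 y) → Tendsto ρ atTop (𝓝 0)) : ∃ᶠ k in atTop, ρ k ≤ T := by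
  intro hidle
  obtain ⟨K, hK⟩ := eventually_atTop.1 hidle
  have hconst : ∀ k ≥ K, X k = X K := fun k hk => by
    induction k, hk using Nat.le_induction with
    | base => rfl
    | succ k hk ih => rw [h.succ_eq_of_lt (not_le.1 (hK k hk)), ih]
  have hlim := hρ (X K) (tendsto_atTop_of_eventually_const hconst)
  obtain ⟨k, hk, hkT⟩ := (hidle.and (hlim.eventually_le_const hT0)).exists
  exact hk hkT

section Residual

variable [CompleteSpace E] (h : IsInexactNewton g J T φ X B ρ a)
  (hg : ∀ x, HasFDerivAt g (J x) x) (hJ : ∀ x, StronglyMonotone μ (J x)) (hL0 : 0 ≤ L)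
  (hL : ∀ x y, ‖J x - J y‖ ≤ L * ‖x - y‖) (hTμ : T < μ)

include h hg hJ hL0 hL hTμ

theorem norm_succ_le {k : ℕ} (hk : ρ k ≤ T) :
    ‖g (X (k + 1))‖ ≤ ‖g (X k)‖ - (1 - (ρ k / (μ - T) +
      L * min ‖g (X k)‖ φ / (2 * (μ - T) ^ 2))) * min ‖g (X k)‖ φ := by
  have hm : 0 < μ - T := sub_pos.2 hTμ
  rw [← h.mul_norm_of_le k hk, h.succ]
  refine (norm_newton_step_le hg hL0 hL hm ((hJ _).of_opNorm_sub_le ((h.norm_sub_le k).trans hk))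
    (h.norm_sub_le k) (h.mem_Icc k)).trans_eq ?_
  field_simp
  ring

variable (hφ : 0 < φ) (hθ : T / (μ - T) + L * φ / (2 * (μ - T) ^ 2) ≤ θ)

include hφ hθ

theorem norm_succ_le_sub {k : ℕ} (hk : ρ k ≤ T) :
    ‖g (X (k + 1))‖ ≤ ‖g (X k)‖ - (1 - θ) * min ‖g (X k)‖ φ := by
  have : 0 < μ - T := sub_pos.2 hTμ
  refine (h.norm_succ_le hg hJ hL0 hL hTμ hk).trans ?_
  gcongr
  calc _ ≤ T / (μ - T) + L * φ / (2 * (μ - T) ^ 2) := by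
        gcongr
        exact min_le_right _ _
    _ ≤ θ := hθ

theorem antitone_norm (hθ1 : θ < 1) : Antitone fun k => ‖g (X k)‖ := by
  refine antitone_nat_of_succ_le fun k => ?_
  rcases le_or_gt (ρ k) T with hk | hk
  · refine (h.norm_succ_le_sub hg hJ hL0 hL hTμ hφ hθ hk).trans (sub_le_self _ ?_)
    exact mul_nonneg (sub_pos.2 hθ1).le (le_min (norm_nonneg _) hφ.le)
  · rw [h.succ_eq_of_lt hk]

variable (hθ1 : θ < 1) (hT0 : 0 < T)
  (hρ : ∀ y, Tendsto X atTop (𝓝 y) → Tendsto ρ atTop (𝓝 0))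

include hθ1 hT0 hρ

theorem tendsto_norm_zero : Tendsto (fun k => ‖g (X k)‖) atTop (𝓝 0) :=
  tendsto_zero_of_frequently_le_sub (ψ := fun u => (1 - θ) * min u φ)
    (h.antitone_norm hg hJ hL0 hL hTμ hφ hθ hθ1) (fun _ => norm_nonneg _) (by fun_prop)
    (fun _ hu => mul_pos (sub_pos.2 hθ1) (lt_min hu hφ))
    ((h.frequently_le hT0 hρ).mono fun _ hk => h.norm_succ_le_sub hg hJ hL0 hL hTμ hφ hθ hk)

theorem tendsto {xs : E} (hxs : g xs = 0) : Tendsto X atTop (𝓝 xs) := by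
  have hgm := StronglyMonotone.of_hasFDerivAt hg hJ
  have hu := h.tendsto_norm_zero hg hJ hL0 hL hTμ hφ hθ hθ1 hT0 hρ
  refine tendsto_iff_norm_sub_tendsto_zero.2 (squeeze_zero (fun _ => norm_nonneg _)
    (fun k => hgm.norm_sub_le (hT0.trans hTμ) (X k) xs) ?_)
  simpa [hxs] using hu.div_const μ

theorem rSuperlinear {xs : E} (hxs : g xs = 0) : RSuperlinear fun k => ‖X k - xs‖ := by
  have hμ : 0 < μ := hT0.trans hTμ
  have hu := h.tendsto_norm_zero hg hJ hL0 hL hTμ hφ hθ hθ1 hT0 hρ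
  have hρ0 := hρ xs (h.tendsto hg hJ hL0 hL hTμ hφ hθ hθ1 hT0 hρ hxs)
  have hfactor : Tendsto (fun k => ρ k / (μ - T) + L * ‖g (X k)‖ / (2 * (μ - T) ^ 2))
      atTop (𝓝 0) := by
    simpa using (hρ0.div_const (μ - T)).add ((hu.const_mul L).div_const (2 * (μ - T) ^ 2))
  have hstep : ∀ᶠ k in atTop, ‖g (X (k + 1))‖ / μ ≤
      (ρ k / (μ - T) + L * ‖g (X k)‖ / (2 * (μ - T) ^ 2)) * (‖g (X k)‖ / μ) := by
    filter_upwards [hρ0.eventually_le_const hT0, hu.eventually_le_const hφ] with k hk hkφ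
    have hfull := h.norm_succ_le hg hJ hL0 hL hTμ hk
    rw [min_eq_left hkφ] at hfull
    rw [← mul_div_assoc]
    gcongr
    linarith
  have hrate : RSuperlinear fun k => ‖g (X k)‖ / μ :=
    rSuperlinear_of_eventually_le (fun k => by positivity) hfactor hstep
  refine hrate.of_le fun k => ?_
  rw [abs_norm]
  have hdist := (StronglyMonotone.of_hasFDerivAt hg hJ).norm_sub_le hμ (X k) xs
  rw [hxs, sub_zero] at hdist
  exact hdist.trans (le_abs_self _)

end Residual

end IsInexactNewton

end InexactNewton

/-! ### The constants of the method -/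

section Constants

variable {μ L M c : ℝ}

theorem threshold_equation (μ M c : ℝ) :
    3 * threshold μ M c ^ 2 + 2 * (M + c) * threshold μ M c = μ ^ 2 := by
  have hsq : √((M + c) ^ 2 + 3 * μ ^ 2) ^ 2 = (M + c) ^ 2 + 3 * μ ^ 2 :=
    Real.sq_sqrt (by positivity)
  unfold threshold
  linear_combination hsq / 3

theorem threshold_pos (hμ : 0 < μ) : 0 < threshold μ M c := by
  have hsqrt : M + c < √((M + c) ^ 2 + 3 * μ ^ 2) := by
    apply Real.lt_sqrt_of_sq_lt
    linarith [pow_pos hμ 2]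
  unfold threshold
  linarith

theorem threshold_lt (hμ : 0 < μ) (hM : μ ≤ M) (hc : 0 < c) : threshold μ M c < μ := by
  have hT := threshold_pos (M := M) (c := c) hμ
  nlinarith [threshold_equation μ M c, mul_pos hT hc, mul_nonneg hT.le (sub_nonneg.2 hM)]

theorem phi_eq (μ L M c : ℝ) :
    phi μ L M c = 2 * (μ - threshold μ M c) / L *
      (μ * (μ - threshold μ M c) / (M + μ) - threshold μ M c) := by
  rw [phi, div_mul_eq_div_div]
  ring

theorem phi_pos (hμ : 0 < μ) (hL : 0 < L) (hM : μ ≤ M) (hc : 0 < c) : 0 < phi μ L M c := by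
  have hT := threshold_pos (M := M) (c := c) hμ
  have hTμ : 0 < μ - threshold μ M c := sub_pos.2 (threshold_lt hμ hM hc)
  have hsqrt : 2 * μ - c < √((M + c) ^ 2 + 3 * μ ^ 2) :=
    Real.lt_sqrt_of_sq_lt (by nlinarith [mul_pos hμ hc])
  have hlin : 2 * μ < 3 * threshold μ M c + M + 2 * c := by
    unfold threshold
    linarith
  have hfactor : threshold μ M c < μ * (μ - threshold μ M c) / (M + μ) := by
    rw [lt_div_iff₀ (by linarith)]
    nlinarith [threshold_equation μ M c]
  rw [phi_eq]
  exact mul_pos (by positivity) (sub_pos.2 hfactor)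

/-- `phi` is the solution of this linear equation: it is the step length at which the contraction
factor of an inexact Newton step with error `threshold` equals `μ / (M + μ)`. -/
theorem contraction_factor_eq (hL : L ≠ 0) (hTμ : threshold μ M c ≠ μ) (hMμ : M + μ ≠ 0) :
    threshold μ M c / (μ - threshold μ M c) +
      L * phi μ L M c / (2 * (μ - threshold μ M c) ^ 2) = μ / (M + μ) := by
  have hne : μ - threshold μ M c ≠ 0 := sub_ne_zero.2 hTμ.symm
  rw [phi_eq]
  field_simp
  ring

section Stepsize

variable {p : ℕ} {r : ℝ}

theorem stepsize_of_threshold_lt (hr : threshold μ M c < r) (g : EuclideanSpace ℝ (Fin p)) :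
    stepsize μ L M c r g = 0 :=
  if_neg hr.not_ge

theorem stepsize_mem_Icc (hφ : 0 ≤ phi μ L M c) (r : ℝ) (g : EuclideanSpace ℝ (Fin p)) :
    stepsize μ L M c r g ∈ Set.Icc 0 1 := by
  unfold stepsize
  split_ifs
  · exact ⟨zero_le_one, le_rfl⟩
  · exact ⟨by positivity, min_le_left _ _⟩
  · exact ⟨le_rfl, zero_le_one⟩

theorem stepsize_mul_norm (hφ : 0 ≤ phi μ L M c) (hr : r ≤ threshold μ M c)
    (g : EuclideanSpace ℝ (Fin p)) : stepsize μ L M c r g * ‖g‖ = min ‖g‖ (phi μ L M c) := by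
  rw [stepsize, if_pos hr]
  split_ifs with hg
  · simp [hg, hφ]
  · rw [min_mul_of_nonneg _ _ (norm_nonneg g), one_mul, div_mul_cancel₀ _ (norm_ne_zero_iff.2 hg)]

end Stepsize

end Constants

/-! ### Executions of the algorithm -/

namespace DANLA

open Filter Topology

variable {n p : ℕ} [NeZero p] {ι : Type*} {G : Digraph (Fin n)} {P : Protocol G}
  {ident : Fin n → ι} {f : Fin n → EuclideanSpace ℝ (Fin p) → ℝ} {μ L M c : ℝ}
  {x₀ : EuclideanSpace ℝ (Fin p)} (R : DANLA P ident f μ L M c x₀)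

theorem x_succ_eq_sub (k : ℕ) (i : Fin n) :
    R.x (k + 1) i = R.x k i - R.α k i • (R.Hhat (k + 1) i).inverse (R.ghat k i) := by
  rw [R.x_succ]
  split_ifs with hα
  · rw [hα, zero_smul, sub_zero]
  · rfl

variable (hG : StronglyConnected G) (hident : Function.Injective ident)

include hG hident

theorem sum_known {E : Type*} [AddCommMonoid E] (ψ : ι × Message p → E) (k : ℕ) (i : Fin n) :
    ∑ m ∈ R.known k P.rounds i, ψ m =
      ∑ l, ψ (ident l, ⟨R.r k l, R.s k l, R.g k l, R.h k l⟩) :=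
  (R.flooding k).sum_known_rounds (fun _ _ h => hident (congrArg Prod.fst h)) hG ψ i

theorem ghat_eq_sum (k : ℕ) (i : Fin n) : R.ghat k i = ∑ l, R.g k l := by
  rw [R.ghat_eq, R.sum_known hG hident fun m => m.2.g]

theorem rhat_eq_sum (k : ℕ) (i : Fin n) : R.rhat k i = ∑ l, R.r k l := by
  rw [R.rhat_eq, R.sum_known hG hident fun m => m.2.r]

theorem Hhat_eq_sum (k : ℕ) (i : Fin n) : R.Hhat k i = ∑ l, R.H k l := by
  induction k with
  | zero => simp [R.Hhat_zero, R.H_zero]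
  | succ k ih =>
    rw [R.Hhat_succ, R.sum_known hG hident fun m => signedOuter m.2.s m.2.h, ih,
      ← Finset.sum_add_distrib]
    exact Finset.sum_congr rfl fun l _ => (R.H_succ k l).symm

theorem x_eq (k : ℕ) (i j : Fin n) : R.x k i = R.x k j := by
  induction k with
  | zero => rw [R.x_zero, R.x_zero]
  | succ k ih =>
    simp only [R.x_succ, R.α_eq, R.rhat_eq_sum hG hident, R.ghat_eq_sum hG hident,
      R.Hhat_eq_sum hG hident, ih]

theorem ghat_eq_gradient_sum (hf : ∀ l, ContDiff ℝ 2 (f l)) (k : ℕ) (i : Fin n) :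
    R.ghat k i = gradient (fun y => ∑ l, f l y) (R.x k i) := by
  rw [R.ghat_eq_sum hG hident,
    gradient_sum fun l _ => (hf l).contDiffAt.differentiableAt two_ne_zero]
  exact Finset.sum_congr rfl fun l _ => by rw [R.g_eq, R.x_eq hG hident k l i]

theorem isRankOneApprox (k : ℕ) (i l : Fin n) :
    IsRankOneApprox (hessian (f l) (R.x k i) - R.H k l) (R.s k l) (R.h k l) (R.r k l) :=
  R.x_eq hG hident k l i ▸ R.rankOne k l

theorem norm_hessian_sub_Hhat_le (hf : ∀ l, ContDiff ℝ 2 (f l)) (k : ℕ) (i : Fin n) :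
    ‖hessian (fun y => ∑ l, f l y) (R.x k i) - R.Hhat (k + 1) i‖ ≤ R.rhat k i := by
  rw [hessian_sum fun l _ => hf l, R.Hhat_eq_sum hG hident, R.rhat_eq_sum hG hident,
    ← Finset.sum_sub_distrib]
  refine norm_sum_le_of_le _ fun l _ => ?_
  rw [R.H_succ, ← sub_sub, (R.isRankOneApprox hG hident k i l).norm_sub_eq]

theorem rhat_add_le_sum_drift (k : ℕ) (i : Fin n) :
    R.rhat (k + p) i ≤ ∑ l, ∑ m ∈ Finset.range p,
      ‖hessian (f l) (R.x (k + m + 1) i) - hessian (f l) (R.x (k + m) i)‖ := by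
  rw [R.rhat_eq_sum hG hident]
  refine Finset.sum_le_sum fun l _ => ?_
  refine IsRankOneApprox.remainder_le_sum_drift (fun k => R.isRankOneApprox hG hident k i l)
    (D := fun k => hessian (f l) (R.x (k + 1) i) - hessian (f l) (R.x k i)) (fun k => ?_) k
  rw [R.H_succ]
  abel

theorem tendsto_rhat_zero (hf : ∀ l, ContDiff ℝ 2 (f l)) {i : Fin n}
    {y : EuclideanSpace ℝ (Fin p)} (hy : Tendsto (fun k => R.x k i) atTop (𝓝 y)) :
    Tendsto (fun k => R.rhat k i) atTop (𝓝 0) := by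
  have hdrift : ∀ l m, Tendsto (fun k => ‖hessian (f l) (R.x (k + m + 1) i) -
      hessian (f l) (R.x (k + m) i)‖) atTop (𝓝 0) := fun l m => by
    have hlim := ((continuous_hessian (hf l)).tendsto y).comp hy
    simpa [Function.comp_def, add_assoc] using ((hlim.comp (tendsto_add_atTop_nat (m + 1))).sub
      (hlim.comp (tendsto_add_atTop_nat m))).norm
  have hsum := tendsto_finsetSum Finset.univ fun l _ =>
    tendsto_finsetSum (Finset.range p) fun m _ => hdrift l m
  simp only [Finset.sum_const_zero] at hsum
  refine (tendsto_add_atTop_iff_nat p).1 (squeeze_zero (fun k => ?_)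
    (fun k => R.rhat_add_le_sum_drift hG hident k i) hsum)
  exact (norm_nonneg _).trans (R.norm_hessian_sub_Hhat_le hG hident hf (k + p) i)

theorem isInexactNewton (hf : ∀ l, ContDiff ℝ 2 (f l)) (hφ : 0 ≤ phi μ L M c) (i : Fin n) :
    IsInexactNewton (gradient fun y => ∑ l, f l y) (hessian fun y => ∑ l, f l y)
      (threshold μ M c) (phi μ L M c) (fun k => R.x k i) (fun k => R.Hhat (k + 1) i)
      (fun k => R.rhat k i) (fun k => R.α k i) where
  norm_sub_le k := R.norm_hessian_sub_Hhat_le hG hident hf k i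
  succ k := by rw [R.x_succ_eq_sub, R.ghat_eq_gradient_sum hG hident hf]
  mem_Icc k := R.α_eq k i ▸ stepsize_mem_Icc hφ _ _
  mul_norm_of_le k hk := by
    rw [R.α_eq, ← R.ghat_eq_gradient_sum hG hident hf, stepsize_mul_norm hφ hk]
  eq_zero_of_lt k hk := by rw [R.α_eq, stepsize_of_threshold_lt hk]

theorem rSuperlinear (hf : ∀ l, ContDiff ℝ 2 (f l)) (hμ : 0 < μ) (hL : 0 < L)
    (hM : μ ≤ M) (hc : 0 < c)
    (hμf : ∀ x, StronglyMonotone μ (hessian (fun y => ∑ l, f l y) x))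
    (hLf : ∀ x y, ‖hessian (fun y => ∑ l, f l y) x - hessian (fun y => ∑ l, f l y) y‖ ≤
      L * ‖x - y‖)
    {xs : EuclideanSpace ℝ (Fin p)} (hxs : gradient (fun y => ∑ l, f l y) xs = 0) (i : Fin n) :
    RSuperlinear fun k => ‖R.x k i - xs‖ := by
  have hφ : 0 < phi μ L M c := phi_pos hμ hL hM hc
  have hTμ : threshold μ M c < μ := threshold_lt hμ hM hc
  have hMμ : 0 < M + μ := by linarith
  have hfactor : μ / (M + μ) < 1 := (div_lt_one hMμ).2 (by linarith)
  exact (R.isInexactNewton hG hident hf hφ.le i).rSuperlinear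
    (hasFDerivAt_gradient (ContDiff.sum fun l _ => hf l)) hμf hL.le hLf hTμ hφ
    (contraction_factor_eq hL.ne' hTμ.ne hMμ.ne').le hfactor (threshold_pos hμ)
    (fun _ hy => R.tendsto_rhat_zero hG hident hf hy) hxs

end DANLA

end DistributedNewton

theorem theorem3_general {n p : ℕ} [NeZero p]
    (f : Fin n → EuclideanSpace ℝ (Fin p) → ℝ)
    (hf : ∀ i, ContDiff ℝ 2 (f i))
    {μ L M : ℝ} (hμ : 0 < μ) (hL : 0 < L)
    (hμf : ∀ x v, μ * ‖v‖ ^ 2 ≤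
      inner ℝ (DistributedNewton.hessian (fun y => ∑ i, f i y) x v) v)
    (hLf : ∀ x y, ‖DistributedNewton.hessian (fun y => ∑ i, f i y) x -
      DistributedNewton.hessian (fun y => ∑ i, f i y) y‖ ≤ L * ‖x - y‖)
    (hM : μ ≤ M)
    (G : Digraph (Fin n)) (hG : DistributedNewton.StronglyConnected G)
    (P : DistributedNewton.Protocol G)
    {ι : Type*} (ident : Fin n → ι) (hident : Function.Injective ident)
    {c : ℝ} (hc : 0 < c) (x₀ : EuclideanSpace ℝ (Fin p)) :
    ∃ xs : EuclideanSpace ℝ (Fin p),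
      (∀ y, y ≠ xs → ∑ i, f i xs < ∑ i, f i y) ∧
      ∀ (R : DistributedNewton.DANLA P ident f μ L M c x₀) (i : Fin n),
        DistributedNewton.RSuperlinear (fun k => ‖R.x k i - xs‖) := by
  have hF : ContDiff ℝ 2 fun y => ∑ i, f i y := ContDiff.sum fun i _ => hf i
  have hJ : ∀ x, DistributedNewton.StronglyMonotone μ
      (DistributedNewton.hessian (fun y => ∑ i, f i y) x) :=
    fun x => DistributedNewton.stronglyMonotone_iff.2 (hμf x)
  have hgrad : ∀ x, HasGradientAt (fun y => ∑ i, f i y) (gradient (fun y => ∑ i, f i y) x) x :=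
    fun x => (hF.differentiable two_ne_zero x).hasGradientAt
  have hmono := DistributedNewton.StronglyMonotone.of_hasFDerivAt
    (DistributedNewton.hasFDerivAt_gradient hF) hJ
  obtain ⟨xs, hxs⟩ := hmono.exists_eq_zero hμ hgrad
  exact ⟨xs, fun y hy => hmono.lt_of_ne hμ hgrad hxs hy,
    fun R i => R.rSuperlinear hG hident hf hμ hL hM hc hJ hLf hxs i⟩

theorem theorem3 {n p : ℕ} [NeZero p]
    -- local objective functions
    (f : Fin n → EuclideanSpace ℝ (Fin p) → ℝ)
    (hf : ∀ i, ContDiff ℝ 2 (f i))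
    {μ L M : ℝ} (hμ : 0 < μ) (hL : 0 < L)
    -- the sum of the local objectives is `μ`-strongly convex
    (hμf : ∀ x v, μ * ‖v‖ ^ 2 ≤
      inner ℝ (DistributedNewton.hessian (fun y => ∑ i, f i y) x v) v)
    -- with `L`-Lipschitz Hessian
    (hLf : ∀ x y, ‖DistributedNewton.hessian (fun y => ∑ i, f i y) x -
      DistributedNewton.hessian (fun y => ∑ i, f i y) y‖ ≤ L * ‖x - y‖)
    -- bounded above by `M I`
    (hMf : ∀ x v,
      inner ℝ (DistributedNewton.hessian (fun y => ∑ i, f i y) x v) v ≤ M * ‖v‖ ^ 2)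
    -- a strongly connected network whose nodes have unique identifiers
    (G : Digraph (Fin n)) (hG : DistributedNewton.StronglyConnected G)
    (P : DistributedNewton.Protocol G)
    {ι : Type*} (ident : Fin n → ι) (hident : Function.Injective ident)
    {c : ℝ} (hc : 0 < c) (x₀ : EuclideanSpace ℝ (Fin p)) :
    -- there is a unique optimal point, to which every execution converges at every node
    ∃ xs : EuclideanSpace ℝ (Fin p),
      (∀ y, y ≠ xs → ∑ i, f i xs < ∑ i, f i y) ∧
      ∀ (R : DistributedNewton.DANLA P ident f μ L M c x₀) (i : Fin n),
        DistributedNewton.RSuperlinear (fun k => ‖R.x k i - xs‖) := by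
  have hM : μ ≤ M := by
    simpa using (hμf 0 (EuclideanSpace.single 0 1)).trans (hMf 0 (EuclideanSpace.single 0 1))
  exact theorem3_general f hf hμ hL hμf hLf hM G hG P ident hident hc x₀
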